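/- Conventions. A topos is an elementary topos. It is 2-valued if its terminal object $1$ has exactly two subobjects; supports split in it if every epimorphism $X\to U$ onto a subobject $U$ of $1$ has a section; it is boolean if every subobject is complemented. A topos $\mathcal{E}$ is precohesive over a topos $\mathcal{S}$ if there is a string of adjoint functors $F_!\dashv F^*\dashv F_*\dashv F^!$, with $F_!,F_*:\mathcal{E}\to\mathcal{S}$ and $F^*,F^!:\mathcal{S}\to\mathcal{E}$, such that $F^*$ is fully faithful, the counit of $F^*\dashv F_*$ is monic, and $F_!$ preserves finite products. A McLarty topos is a 2-valued topos in which supports split and which is precohesive over a boolean topos; an object $X$ of it is connected if $F_!X$ is terminal. An object $T$ of a cartesian closed category is atomic if the exponential functor $(-)^T$ has a right adjoint. A point of $X$ is an arrow $1\to X$. Theorem. There is a McLarty topos $\mathcal{E}$ with an atomic object $A$ that is connected and has a countably infinite number of points. More precisely, there are a category $C$ with countably many arrows and an object $t$ of $C$ such that one can take $\mathcal{E}=\mathbf{Set}^C$ (functors $C\to\mathbf{Set}$) and $A=C(t,-)$; here $A$ is connected with respect to every precohesion of $\mathcal{E}$ over a boolean topos. -/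

import Mathlib

open CategoryTheory CategoryTheory.Limits MonoidalCategory

universe u v u' v'

/-- An elementary topos: a category with finite limits and a subobject classifier that is
cartesian closed. -/
class IsElementaryTopos (E : Type u) [Category.{v} E] : Prop extends
    HasFiniteLimits E, HasSubobjectClassifier E where
  cartesianClosed : ∃ _ : CartesianMonoidalCategory E, Nonempty (MonoidalClosed E)

/-- Every subobject is complemented: every monomorphism `U ⟶ X` is one of the two injections of
a coproduct decomposition `X ≅ U + V`. -/
def IsBoolean (E : Type u) [Category.{v} E] : Prop :=
  ∀ ⦃U X : E⦄ (m : U ⟶ X) [Mono m],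
    ∃ (V : E) (n : V ⟶ X), Nonempty (IsColimit (BinaryCofan.mk m n))

/-- The terminal object has exactly two subobjects (equivalently, there are exactly two truth
values `1 ⟶ Ω`). -/
def IsTwoValued (E : Type u) [Category.{v} E] [HasTerminal E] : Prop :=
  Nat.card (Subobject (⊤_ E)) = 2

/-- Every epimorphism onto a subobject of the terminal object has a section. -/
def SupportsSplit (E : Type u) [Category.{v} E] [HasTerminal E] : Prop :=
  ∀ ⦃X U : E⦄ (e : X ⟶ U) [Epi e] [Mono (terminal.from U)], IsSplitEpi e

/-- A precohesion of `E` over the base `S`: a string of adjoint functors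
`pieces ⊣ discrete ⊣ points ⊣ codiscrete` with `discrete` fully faithful, the counit of
`discrete ⊣ points` monic, and `pieces` preserving finite products. -/
structure Precohesion (E : Type u) [Category.{v} E] (S : Type u') [Category.{v'} S] where
  pieces : E ⥤ S
  discrete : S ⥤ E
  points : E ⥤ S
  codiscrete : S ⥤ E
  piecesAdj : pieces ⊣ discrete
  pointsAdj : discrete ⊣ points
  codiscreteAdj : points ⊣ codiscrete
  full : discrete.Full
  faithful : discrete.Faithful
  mono_counit : ∀ X : E, Mono (pointsAdj.counit.app X)
  preservesFiniteProducts : PreservesFiniteProducts pieces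

/-- An object is connected if its object of pieces is terminal in the base. -/
def Precohesion.IsConnected {E : Type u} [Category.{v} E] {S : Type u'} [Category.{v'} S]
    (P : Precohesion E S) (X : E) : Prop :=
  Nonempty (IsTerminal (P.pieces.obj X))

/-- A McLarty topos: a two-valued topos in which supports split and which is precohesive over
a boolean topos. -/
class IsMcLartyTopos (E : Type u) [Category.{v} E] : Prop extends IsElementaryTopos E where
  twoValued : IsTwoValued E
  supportsSplit : SupportsSplit E
  precohesive : ∃ (S : Type u) (_ : Category.{v} S),
    IsElementaryTopos S ∧ IsBoolean S ∧ Nonempty (Precohesion E S)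

/-- An object `T` of a cartesian closed category is atomic if the exponential functor `(-)^T`
has a right adjoint. -/
def IsAtomicObject {E : Type u} [Category.{v} E] [CartesianMonoidalCategory E]
    [MonoidalClosed E] (T : E) : Prop :=
  (ihom T).IsLeftAdjoint

open Opposite

/-!
Let `C` be a small category with binary coproducts and an initial object `I` such that every object
has an arrow to `I`. The points of a copresheaf on `C` are its elements at `I`, and a copresheaf
without points is empty, so that `C ⥤ Type` is two-valued and supports split. Colimits over `C`
preserve finite products, which yields the precohesion over sets. By the Yoneda lemma,
exponentiation by `Hom(t, -)` is precomposition with `- ⨿ t`, whose right adjoint is a right Kan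
extension. For connectedness, corepresentables are indecomposable and pieces preserve
indecomposable objects, while over a boolean base an indecomposable object with a point is terminal.

If `C` consists of the finitely generated free models of the theory with one constant for each
element of `K`, and `t` is free on one generator, then the points of `Hom(t, -)` are the arrows from
`t` to the initial model, i.e. the constants.
-/

section Boolean

/-- An object `X` is indecomposable if every arrow `X ⟶ A + B` factors through exactly one of the
two coproduct injections. Where these injections are monic, this says that `Hom(X, -)` preserves
binary coproducts; the elementwise form makes sense across categories whose homs live in different
universes. -/
def IsIndecomposable {E : Type u} [Category.{v} E] (X : E) : Prop :=
  ∀ ⦃A B Y : E⦄ (i : A ⟶ Y) (j : B ⟶ Y), IsColimit (BinaryCofan.mk i j) → ∀ f : X ⟶ Y,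
    Xor (∃ g, g ≫ i = f) (∃ g, g ≫ j = f)

variable {E : Type u} [Category.{v} E] {S : Type u'} [Category.{v'} S]

theorem IsIndecomposable.leftAdjoint_obj {F : E ⥤ S} {G : S ⥤ E} (adj : F ⊣ G)
    [PreservesColimitsOfShape (Discrete WalkingPair) G] {X : E} (hX : IsIndecomposable X) :
    IsIndecomposable (F.obj X) := by
  intro A B Y i j hY f
  have factors_iff {Z : S} (k : Z ⟶ Y) :
      (∃ g, g ≫ G.map k = adj.homEquiv X Y f) ↔ ∃ g, g ≫ k = f := by
    simp only [(adj.homEquiv X Z).surjective.exists, ← adj.homEquiv_naturality_right,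
      EmbeddingLike.apply_eq_iff_eq]
  rw [← factors_iff, ← factors_iff]
  exact hX _ _ (mapIsColimitOfPreservesOfIsColimit G i j hY) _

/-- The point `y` is a summand of `Y`, and by indecomposability `𝟙 Y` factors through `y`: it cannot
factor through the complement of `y`, because then so would `y`. -/
theorem IsBoolean.nonempty_isTerminal_of_isIndecomposable (hS : IsBoolean S) {T Y : S}
    (hT : IsTerminal T) (indT : IsIndecomposable T) (indY : IsIndecomposable Y) (y : T ⟶ Y) :
    Nonempty (IsTerminal Y) := by
  have : Mono y := hT.mono_from y
  obtain ⟨V, n, ⟨hc⟩⟩ := hS y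
  obtain ⟨s, hs⟩ | ⟨s, hs⟩ := Xor.or (indY _ _ hc (𝟙 Y))
  · have : IsSplitEpi y := ⟨⟨s, hs⟩⟩
    have : IsIso y := isIso_of_mono_of_isSplitEpi y
    exact ⟨hT.ofIso (asIso y)⟩
  · have y_through_y : ∃ g, g ≫ y = y := ⟨𝟙 T, Category.id_comp y⟩
    have y_through_n : ∃ g, g ≫ n = y := ⟨y ≫ s, by
      rw [Category.assoc, hs, Category.comp_id]⟩
    exact absurd (iff_of_true y_through_y y_through_n) ((xor_iff_not_iff _ _).1 (indT _ _ hc y))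

theorem Precohesion.isConnected_of_isIndecomposable (P : Precohesion E S) (hS : IsBoolean S)
    {T X : E} (hT : IsTerminal T) (indT : IsIndecomposable T) (indX : IsIndecomposable X)
    (x : T ⟶ X) : P.IsConnected X :=
  have := P.preservesFiniteProducts
  have : PreservesColimitsOfShape (Discrete WalkingPair) P.discrete :=
    (P.pointsAdj.leftAdjoint_preservesColimits).preservesColimitsOfShape
  hS.nonempty_isTerminal_of_isIndecomposable (hT.isTerminalObj P.pieces)
    (indT.leftAdjoint_obj P.piecesAdj) (indX.leftAdjoint_obj P.piecesAdj) (P.pieces.map x)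

end Boolean

section PointedOrInitial

variable {E : Type u} [Category.{v} E] [HasTerminal E] [InitialMonoClass E]

theorem supportsSplit_of_point_or_isInitial [Balanced E]
    (h : ∀ X : E, Nonempty (⊤_ E ⟶ X) ∨ Nonempty (IsInitial X)) : SupportsSplit E := by
  intro X U e _ _
  obtain ⟨⟨x⟩⟩ | ⟨⟨hX⟩⟩ := h X
  · exact ⟨⟨⟨terminal.from U ≫ x, (cancel_mono (terminal.from U)).1 (Subsingleton.elim _ _)⟩⟩⟩
  · have : Mono e := hX.mono_from e
    have : IsIso e := isIso_of_mono_of_epi e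
    infer_instance

theorem isTwoValued_of_point_or_isInitial [HasInitial E] (h01 : IsEmpty (⊤_ E ⟶ ⊥_ E))
    (h : ∀ X : E, Nonempty (⊤_ E ⟶ X) ∨ Nonempty (IsInitial X)) : IsTwoValued E := by
  refine Nat.card_eq_two_iff.2 ⟨⊥, ⊤, fun hbot => ?_, Set.eq_univ_of_forall fun U => ?_⟩
  · have : IsIso (initial.to (⊤_ E)) := (Subobject.isIso_iff_mk_eq_top _).2 hbot
    exact h01.elim (inv (initial.to (⊤_ E)))
  · obtain ⟨⟨x⟩⟩ | ⟨⟨hU⟩⟩ := h (U : E)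
    · have : IsSplitEpi U.arrow := ⟨⟨x, Subsingleton.elim _ _⟩⟩
      have : IsIso U.arrow := isIso_of_mono_of_isSplitEpi U.arrow
      exact Or.inr (Subobject.eq_top_of_isIso_arrow U)
    · exact Or.inl (le_bot_iff.1 (Subobject.le_of_comm (hU.to _) (hU.hom_ext _ _)))

end PointedOrInitial

section ElementaryTopos

theorem hasSubobjectClassifier_of_equivalence {D : Type u} [Category.{v} D]
    [HasSubobjectClassifier D] {E : Type u'} [Category.{v'} E] [HasPullbacks E] (e : D ≌ E) :
    HasSubobjectClassifier E where
  exists_classifier := HasSubobjectClassifier.exists_classifier.map (·.ofEquivalence e)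

theorem isElementaryTopos_copresheaf (C : Type u) [SmallCategory C] :
    IsElementaryTopos (C ⥤ Type u) where
  toHasSubobjectClassifier :=
    hasSubobjectClassifier_of_equivalence (opOpEquivalence C).congrLeft
  cartesianClosed := ⟨inferInstance, ⟨inferInstance⟩⟩

theorem isElementaryTopos_type : IsElementaryTopos (Type u) where
  toHasSubobjectClassifier :=
    have := (isElementaryTopos_copresheaf (Discrete PUnit.{u + 1})).toHasSubobjectClassifier
    hasSubobjectClassifier_of_equivalence Functor.equiv
  cartesianClosed := ⟨inferInstance, ⟨inferInstance⟩⟩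

theorem isBoolean_type : IsBoolean (Type u) :=
  fun _ _ m _ => ⟨_, _, ⟨Types.isCoprodOfMono m⟩⟩

end ElementaryTopos

section Copresheaf

variable {C : Type u} [SmallCategory C] {I : C}

theorem isIndecomposable_coyoneda (t : C) : IsIndecomposable (coyoneda.obj (op t)) := by
  intro A B Y i j hY f
  have hYt := mapIsColimitOfPreservesOfIsColimit ((evaluation C (Type u)).obj t) i j hY
  have hcompl : IsCompl (Set.range (i.app t)) (Set.range (j.app t)) :=
    ((Types.binaryCofan_isColimit_iff _).1 ⟨hYt⟩).2.2
  have factors_iff {Z : C ⥤ Type u} (k : Z ⟶ Y) :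
      (∃ g, g ≫ k = f) ↔ coyonedaEquiv f ∈ Set.range (k.app t) := by
    simp only [coyonedaEquiv.symm.surjective.exists, ← coyonedaEquiv.apply_eq_iff_eq,
      coyonedaEquiv_comp, Equiv.apply_symm_apply, Set.mem_range]
  rw [factors_iff, factors_iff, ← hcompl.compl_eq, Set.mem_compl_iff, xor_not_right]

/-- The copresheaf corepresented by an initial object is terminal. -/
def isTerminalCoyonedaOfIsInitial (hI : IsInitial I) : IsTerminal (coyoneda.obj (op I)) :=
  Functor.isTerminal fun c => (Types.isTerminalEquivUnique _).symm
    { default := hI.to c, uniq := fun _ => hI.hom_ext _ _ }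

/-- The points of a copresheaf are its elements at an initial object. -/
noncomputable def pointsEquivOfIsInitial (hI : IsInitial I) (X : C ⥤ Type u) :
    (⊤_ (C ⥤ Type u) ⟶ X) ≃ X.obj I :=
  ((terminalIsTerminal.uniqueUpToIso (isTerminalCoyonedaOfIsInitial hI)).homCongr
    (Iso.refl X)).trans coyonedaEquiv

theorem point_or_isInitial_of_forall_hom (hI : IsInitial I) (r : ∀ c : C, Nonempty (c ⟶ I))
    (X : C ⥤ Type u) : Nonempty (⊤_ (C ⥤ Type u) ⟶ X) ∨ Nonempty (IsInitial X) := by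
  rw [(pointsEquivOfIsInitial hI X).nonempty_congr, or_iff_not_imp_left, not_nonempty_iff]
  intro hXI
  have hempty (c : C) : IsEmpty (X.obj c) := (r c).elim fun f => Function.isEmpty (X.map f)
  exact ⟨Functor.isInitial fun c => ((Types.initial_iff_empty _).2 (hempty c)).some⟩

theorem isEmpty_terminal_hom_initial [Nonempty C] :
    IsEmpty (⊤_ (C ⥤ Type u) ⟶ ⊥_ (C ⥤ Type u)) := by
  obtain ⟨c⟩ := ‹Nonempty C›
  have : IsEmpty ((⊥_ (C ⥤ Type u)).obj c) := (Types.initial_iff_empty _).1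
    ⟨initialIsInitial.isInitialObj ((evaluation C (Type u)).obj c)⟩
  exact ⟨fun f => isEmptyElim (coyonedaEquiv (terminal.from (coyoneda.obj (op c)) ≫ f))⟩

/-- Evaluation at an initial object is right adjoint to the formation of constant functors. -/
def constEvaluationAdjunction {D : Type u'} [Category.{v'} D] (hI : IsInitial I) :
    Functor.const C ⊣ (evaluation C D).obj I where
  unit := (Functor.constCompEvaluationObj D I).inv
  counit :=
    { app := fun X =>
        { app := fun c => X.map (hI.to c)
          naturality := fun c d f => by
            simp [← X.map_comp] } }

/-- The precohesion of copresheaves over sets: pieces are given by the colimit, which preserves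
finite products because `C` is sifted, and points by evaluation at the initial object. -/
noncomputable def precohesionOverType [IsSifted C] (hI : IsInitial I)
    (r : ∀ c : C, Nonempty (c ⟶ I)) : Precohesion (C ⥤ Type u) (Type u) where
  pieces := colim
  discrete := Functor.const C
  points := (evaluation C (Type u)).obj I
  codiscrete := evaluationRightAdjoint (Type u) I
  piecesAdj := colimConstAdj
  pointsAdj := constEvaluationAdjunction hI
  codiscreteAdj := evaluationAdjunctionLeft (Type u) I
  full := inferInstance
  faithful := inferInstance
  mono_counit X := by
    have (c : C) : Mono (((constEvaluationAdjunction hI).counit.app X).app c) := by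
      obtain ⟨f⟩ := r c
      have retraction : X.map (hI.to c) ≫ X.map f = 𝟙 _ := by
        rw [← X.map_comp, hI.hom_ext (hI.to c ≫ f) (𝟙 I), X.map_id]
      exact (SplitMono.mk (X.map f) retraction).mono
    exact NatTrans.mono_of_mono_app _
  preservesFiniteProducts := inferInstance

theorem isMcLartyTopos_copresheaf [IsSifted C] (hI : IsInitial I)
    (r : ∀ c : C, Nonempty (c ⟶ I)) : IsMcLartyTopos (C ⥤ Type u) where
  toIsElementaryTopos := isElementaryTopos_copresheaf C
  twoValued := isTwoValued_of_point_or_isInitial isEmpty_terminal_hom_initial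
    (point_or_isInitial_of_forall_hom hI r)
  supportsSplit := supportsSplit_of_point_or_isInitial (point_or_isInitial_of_forall_hom hI r)
  precohesive := ⟨Type u, inferInstance, isElementaryTopos_type, isBoolean_type,
    ⟨precohesionOverType hI r⟩⟩

end Copresheaf

section Atomic

variable {C : Type u} [SmallCategory C] [HasBinaryCoproducts C]

/-- Precomposition with `- ⨿ t`, which is the exponential by the copresheaf corepresented
by `t`. -/
noncomputable abbrev precompCoprod (t : C) : (C ⥤ Type u) ⥤ (C ⥤ Type u) :=
  (Functor.whiskeringLeft C C (Type u)).obj (coprod.functor.flip.obj t)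

/-- The unit of the adjunction between product with `Hom(t, -)` and precomposition with
`- ⨿ t`. -/
noncomputable def tensorCoyonedaUnit (t : C) :
    𝟭 (C ⥤ Type u) ⟶ tensorLeft (coyoneda.obj (op t)) ⋙ precompCoprod t where
  app X :=
    { app := fun c => ↾fun x => (coprod.inr, X.map coprod.inl x)
      naturality := fun c d f => by
        ext x
        refine Prod.ext ?_ ?_
        · change coprod.inr = coprod.inr ≫ coprod.map f (𝟙 t)
          simp
        · change X.map coprod.inl (X.map f x) = X.map (coprod.map f (𝟙 t)) (X.map coprod.inl x)
          simp only [← Functor.map_comp_apply, coprod.inl_map] }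
  naturality X Y α := by
    ext c x
    refine Prod.ext rfl ?_
    exact (NatTrans.naturality_apply α (coprod.inl : c ⟶ c ⨿ t) x).symm

/-- The counit of the adjunction between product with `Hom(t, -)` and precomposition with
`- ⨿ t`. -/
noncomputable def tensorCoyonedaCounit (t : C) :
    precompCoprod t ⋙ tensorLeft (coyoneda.obj (op t)) ⟶ 𝟭 (C ⥤ Type u) where
  app Y :=
    { app := fun c => ↾fun z => Y.map (coprod.desc (𝟙 c) z.1) z.2
      naturality := fun c d f => by
        have map_desc (a : t ⟶ c) :
            Y.map (coprod.map f (𝟙 t)) ≫ Y.map (coprod.desc (𝟙 d) (a ≫ f)) =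
              Y.map (coprod.desc (𝟙 c) a) ≫ Y.map f := by
          simp [← Y.map_comp]
        ext z
        exact ConcreteCategory.congr_hom (map_desc z.1) z.2 }
  naturality X Y α := by
    ext c z
    exact (NatTrans.naturality_apply α (coprod.desc (𝟙 c) z.1) z.2).symm

/-- The exponential by the copresheaf corepresented by `t` is precomposition with `- ⨿ t`: by the
Yoneda lemma, its value at `c` is the set of arrows `Hom(c, -) × Hom(t, -) ⟶ Y`, and the product on
the left is `Hom(c ⨿ t, -)`. -/
noncomputable def tensorCoyonedaAdjunction (t : C) :
    tensorLeft (coyoneda.obj (op t)) ⊣ precompCoprod t where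
  unit := tensorCoyonedaUnit t
  counit := tensorCoyonedaCounit t
  left_triangle_components X := by
    ext c ⟨a, x⟩
    refine Prod.ext (coprod.inr_desc (𝟙 c) a) ?_
    change X.map (coprod.desc (𝟙 c) a) (X.map coprod.inl x) = x
    rw [← Functor.map_comp_apply, coprod.inl_desc, Functor.map_id_apply]
  right_triangle_components Y := by
    ext c y
    have map_map_desc : Y.map (coprod.map coprod.inl (𝟙 t)) ≫
        Y.map (coprod.desc (𝟙 (c ⨿ t)) coprod.inr) = 𝟙 _ := by
      simp [← Y.map_comp]
    exact ConcreteCategory.congr_hom map_map_desc y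

theorem isAtomicObject_coyoneda (t : C) : IsAtomicObject (coyoneda.obj (op t)) :=
  have : (precompCoprod t).IsLeftAdjoint :=
    ((coprod.functor.flip.obj t).ranAdjunction (Type u)).isLeftAdjoint
  Functor.isLeftAdjoint_of_iso
    ((tensorCoyonedaAdjunction t).rightAdjointUniq (ihom.adjunction (coyoneda.obj (op t))))

end Atomic

/-- The category of finitely generated free models of the algebraic theory whose only operations
are the constants `k : K`. The free model on `n` generators has underlying set `Fin n ⊕ K`, so a
morphism sends each generator to a generator or to a constant. -/
structure FreeWithConstants (K : Type) where
  rank : ℕ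

namespace FreeWithConstants

variable {K : Type}

instance : SmallCategory (FreeWithConstants K) where
  Hom a b := Fin a.rank → Fin b.rank ⊕ K
  id _ := Sum.inl
  comp f g := Sum.elim g Sum.inr ∘ f
  id_comp f := Sum.elim_comp_inl f Sum.inr
  comp_id f := congrArg (· ∘ f) Sum.elim_inl_inr
  assoc f g h := by
    rw [← Function.comp_assoc, Sum.comp_elim, Sum.elim_comp_inr]

/-- The model consisting of the constants only is initial. -/
def isInitialZero : IsInitial (⟨0⟩ : FreeWithConstants K) :=
  IsInitial.ofUniqueHom (fun _ => Fin.elim0) fun _ _ => Subsingleton.elim (α := Fin 0 → _) _ _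

/-- The coproduct of free models is free on the disjoint union of the generators. -/
def binaryCofan (a b : FreeWithConstants K) : BinaryCofan a b :=
  BinaryCofan.mk (P := ⟨a.rank + b.rank⟩)
    (fun i => Sum.inl (Fin.castAdd b.rank i)) (fun i => Sum.inl (Fin.natAdd a.rank i))

/-- The universal property of `binaryCofan`. -/
def isColimitBinaryCofan (a b : FreeWithConstants K) : IsColimit (binaryCofan a b) :=
  BinaryCofan.isColimitMk
    (fun s => Fin.append (α := Fin s.pt.rank ⊕ K) s.inl s.inr)
    (fun s => funext (Fin.append_left _ _))
    (fun s => funext (Fin.append_right _ _))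
    (fun s m hl hr => by
      rw [← hl, ← hr]
      exact Fin.append_castAdd_natAdd.symm)

instance : HasBinaryCoproducts (FreeWithConstants K) :=
  have (a b : FreeWithConstants K) : HasColimit (pair a b) := ⟨⟨_, isColimitBinaryCofan a b⟩⟩
  hasBinaryCoproducts_of_hasColimit_pair _

instance : Nonempty (FreeWithConstants K) :=
  ⟨⟨0⟩⟩

instance [Countable K] : Countable (Σ a b : FreeWithConstants K, a ⟶ b) := by
  have : Countable (FreeWithConstants K) :=
    Function.Injective.countable (f := rank) fun ⟨_⟩ ⟨_⟩ h => congrArg mk h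
  have (a b : FreeWithConstants K) : Countable (a ⟶ b) :=
    inferInstanceAs (Countable (Fin a.rank → Fin b.rank ⊕ K))
  infer_instance

instance [Nonempty K] (a b : FreeWithConstants K) : Nonempty (a ⟶ b) :=
  inferInstanceAs (Nonempty (Fin a.rank → Fin b.rank ⊕ K))

/-- Sending the generator of the free model on one generator to a constant. -/
def homOneZeroEquiv : ((⟨1⟩ : FreeWithConstants K) ⟶ ⟨0⟩) ≃ K :=
  (Equiv.funUnique (Fin 1) _).trans (Equiv.emptySum (Fin 0) K)

end FreeWithConstants

theorem theoremT_general (K : Type) [Countable K] [Nonempty K] :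
    ∃ (C : Type) (_ : SmallCategory C) (t : C),
      Countable (Σ a b : C, a ⟶ b) ∧
      IsMcLartyTopos (C ⥤ Type) ∧
      IsAtomicObject (coyoneda.obj (op t)) ∧
      (∀ (S : Type u') (_ : Category.{v'} S), IsBoolean S →
        ∀ P : Precohesion (C ⥤ Type) S, P.IsConnected (coyoneda.obj (op t))) ∧
      Nonempty ((⊤_ (C ⥤ Type) ⟶ coyoneda.obj (op t)) ≃ K) := by
  let hI : IsInitial (⟨0⟩ : FreeWithConstants K) := FreeWithConstants.isInitialZero
  refine ⟨FreeWithConstants K, inferInstance, ⟨1⟩, inferInstance,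
    isMcLartyTopos_copresheaf hI fun _ => inferInstance, isAtomicObject_coyoneda _,
    fun S _ hS P => ?connected,
    ⟨(pointsEquivOfIsInitial hI _).trans FreeWithConstants.homOneZeroEquiv⟩⟩
  obtain ⟨p⟩ : Nonempty ((⟨1⟩ : FreeWithConstants K) ⟶ ⟨0⟩) := inferInstance
  exact P.isConnected_of_isIndecomposable hS (isTerminalCoyonedaOfIsInitial hI)
    (isIndecomposable_coyoneda _) (isIndecomposable_coyoneda _) (coyoneda.map p.op)

theorem theoremT :
    ∃ (C : Type) (_ : SmallCategory C) (t : C),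
      Countable (Σ a b : C, a ⟶ b) ∧
      IsMcLartyTopos (C ⥤ Type) ∧
      IsAtomicObject (coyoneda.obj (Opposite.op t)) ∧
      (∀ (S : Type 1) (_ : Category.{0} S) (_ : IsElementaryTopos S) (_ : IsBoolean S)
        (P : Precohesion (C ⥤ Type) S), P.IsConnected (coyoneda.obj (Opposite.op t))) ∧
      Nonempty ((⊤_ (C ⥤ Type) ⟶ coyoneda.obj (Opposite.op t)) ≃ ℕ) :=
  let ⟨C, _, t, countable, mcLarty, atomic, connected, points⟩ := theoremT_general ℕ
  ⟨C, _, t, countable, mcLarty, atomic, fun S _ _ hS P => connected S _ hS P, points⟩
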